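/- Let $I_1,\dots,I_m$ be a partition of $\{1,\dots,n\}$ into nonempty blocks of consecutive integers, listed in increasing order (so $\max I_i<\min I_j$ for $i<j$), and let $$\mathcal S_{|I_1|,\dots,|I_m|}=\{u\in\mathbb R^n: u_1\le\cdots\le u_n \text{ and } u \text{ is constant on each of } I_1,\dots,I_m\}$$ be the associated block monotone cone. For a closed convex cone $T\subseteq\mathbb R^d$ let $\delta(T)=\mathbb E\|\Pi_T(Z)\|^2$ denote its statistical dimension, where $\Pi_T$ is the Euclidean projection onto $T$ and $Z\sim N(0,I_d)$ is a standard Gaussian vector in $\mathbb R^d$. Let $$V=\Big\{v\in\mathbb R^m:\frac{v_1}{\sqrt{|I_1|}}\le\cdots\le\frac{v_m}{\sqrt{|I_m|}}\Big\}\subseteq\mathbb R^m .$$ Then $\mathcal S_{|I_1|,\dots,|I_m|}\subseteq\mathbb R^n$ is isometric to $V$, in the sense that there is a linear isometry $f:\mathbb R^m\to\mathbb R^n$ with $f(V)=\mathcal S_{|I_1|,\dots,|I_m|}$. The expectations defining the statistical dimensions of the two cones are finite, and $$\delta(\mathcal S_{|I_1|,\dots,|I_m|})=\delta(V).$$ If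 moreover $|I_1|=\cdots=|I_m|$, then $$\delta(\mathcal S_{|I_1|,\dots,|I_m|})=\sum_{j=1}^m\frac1j .$$ -/

import Mathlib

/-- `p` is a nearest point of `C` to `x`, i.e. a minimizer of `q ↦ ‖x - q‖` over `C`. -/
def IsNearestPoint {E : Type*} [NormedAddCommGroup E] (C : Set E) (x p : E) : Prop :=
  p ∈ C ∧ ∀ q ∈ C, ‖x - p‖ ≤ ‖x - q‖

open Classical in
/-- The projection `Π_C(x)` onto `C`: the nearest point of `C` to `x`. By
`isNearestPoint_iff_eq_metricProj` it is the unique one when `C` is nonempty, closed and convex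
in a Euclidean space. If there is no nearest point the value is `0`. -/
noncomputable def metricProj {E : Type*} [NormedAddCommGroup E] (C : Set E) (x : E) : E :=
  if h : ∃ p, IsNearestPoint C x p then h.choose else 0

/-- Projection onto a nonempty closed convex subset of a Euclidean space is well defined. -/
theorem isNearestPoint_iff_eq_metricProj {n : ℕ} {C : Set (EuclideanSpace ℝ (Fin n))}
    (hne : C.Nonempty) (hcl : IsClosed C) (hconv : Convex ℝ C)
    (x p : EuclideanSpace ℝ (Fin n)) :
    IsNearestPoint C x p ↔ p = metricProj C x := by
  have key : ∀ q, IsNearestPoint C x q → ∀ w ∈ C, inner ℝ (x - q) (w - q) ≤ 0 := by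
    intro q hq
    refine (norm_eq_iInf_iff_real_inner_le_zero hconv hq.1).1 ?_
    have : Nonempty C := hne.to_subtype
    refine le_antisymm (le_ciInf fun w => hq.2 w w.2) ?_
    exact ciInf_le ⟨0, by rintro _ ⟨w, rfl⟩; exact norm_nonneg _⟩ (⟨q, hq.1⟩ : C)
  have uniq : ∀ q r, IsNearestPoint C x q → IsNearestPoint C x r → q = r := by
    intro q r hq hr
    have h1 := key q hq r hr.1
    have h2 := key r hr q hq.1
    have h3 : inner ℝ (r - q) (r - q) ≤ 0 := by
      have e : inner ℝ (r - q) (r - q) = inner ℝ (x - q) (r - q) + inner ℝ (x - r) (q - r) := by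
        rw [← neg_sub r q, inner_neg_right, ← sub_eq_add_neg, ← inner_sub_left]
        congr 1
        abel
      linarith
    rw [real_inner_self_eq_norm_sq] at h3
    have h4 : ‖r - q‖ = 0 := by nlinarith [norm_nonneg (r - q)]
    exact (sub_eq_zero.1 (norm_eq_zero.1 h4)).symm
  have ex : ∃ q, IsNearestPoint C x q := by
    obtain ⟨q, hq, hmin⟩ := hcl.exists_infDist_eq_dist hne x
    refine ⟨q, hq, fun w hw => ?_⟩
    rw [← dist_eq_norm, ← dist_eq_norm, ← hmin]
    exact Metric.infDist_le_dist_of_mem hw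
  have spec : IsNearestPoint C x (metricProj C x) := by
    rw [metricProj, dif_pos ex]
    exact ex.choose_spec
  exact ⟨fun h => uniq _ _ h spec, fun h => h ▸ spec⟩

/-- The statistical dimension `δ(T) = 𝔼 ‖Π_T(Z)‖²`, with `Z` standard Gaussian in `ℝⁿ`. -/
noncomputable def statDim {n : ℕ} (T : Set (EuclideanSpace ℝ (Fin n))) : ℝ :=
  ∫ z, ‖metricProj T z‖ ^ 2 ∂ProbabilityTheory.stdGaussian (EuclideanSpace ℝ (Fin n))

/-- The expectation defining the statistical dimension of `T` is that of an integrable variable. -/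
def StatDimIntegrable {n : ℕ} (T : Set (EuclideanSpace ℝ (Fin n))) : Prop :=
  MeasureTheory.Integrable (fun z => ‖metricProj T z‖ ^ 2)
    (ProbabilityTheory.stdGaussian (EuclideanSpace ℝ (Fin n)))

/-- `I 0, …, I (m - 1)` is a partition of the `n` indices into (nonempty) blocks of consecutive
indices, listed in increasing order. -/
structure IsBlockPartition {n m : ℕ} (I : Fin m → Finset (Fin n)) : Prop where
  isBlock : ∀ j, ∃ k l : Fin n, k ≤ l ∧ I j = Finset.Icc k l
  increasing : ∀ i j, i < j → ∀ a ∈ I i, ∀ b ∈ I j, a < b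
  cover : ∀ a, ∃ j, a ∈ I j

/-- The monotone cone `{u ∈ ℝⁿ : u₁ ≤ ⋯ ≤ uₙ}`. -/
def monotoneCone (n : ℕ) : Set (EuclideanSpace ℝ (Fin n)) :=
  {u | ∀ i j : Fin n, i ≤ j → u i ≤ u j}

/-- The block monotone cone: nondecreasing vectors that are constant on each block. -/
def blockMonotoneCone {n m : ℕ} (I : Fin m → Finset (Fin n)) : Set (EuclideanSpace ℝ (Fin n)) :=
  {u | u ∈ monotoneCone n ∧ ∀ j, ∀ a ∈ I j, ∀ b ∈ I j, u a = u b}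

/-- The cone `{v ∈ ℝᵐ : v₁ / √s₁ ≤ ⋯ ≤ vₘ / √sₘ}`. -/
def scaledMonotoneCone {m : ℕ} (s : Fin m → ℕ) : Set (EuclideanSpace ℝ (Fin m)) :=
  {v | ∀ i j : Fin m, i ≤ j → v i / Real.sqrt (s i) ≤ v j / Real.sqrt (s j)}

/-! Spreading `v j / √|I j|` over the `j`-th block is a linear isometry `f` with `f(V)` the block
cone. The projection onto `f(V)` is `f ∘ Π_V ∘ f*`, and `f*` carries the standard Gaussian to the
standard Gaussian, so the statistical dimensions agree.

For equal blocks `V` is the monotone cone of `ℝᵐ`, and `δ = ∑ 1/j` comes from a random walk. Let `u`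
be the projection of `z`. Testing optimality of `u` against perturbations that stay in the cone
gives, for every `t`, `∑ (-u i - t)⁺ = max_{k ≤ m} ∑_{i<k} (-z i - t)`. By Spitzer's identity the
right side has mean `∑ₖ E(Sₖ - k t)⁺ / k` over `1 ≤ k ≤ m`, with `Sₖ` Gaussian of variance `k`.
Integrating over `t > 0` turns `(x - c t)⁺` into `(x⁺)² / (2c)`, and `E(Sₖ⁺)² = k/2`, so `E ∑ (u
i⁻)² / 2 = ∑ₖ 1/(4k)`. Negating and reversing coordinates preserves both cone and Gaussian, so the
positive parts contribute as much as the negative ones, and the total is `∑ₖ 1/k`. -/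

open MeasureTheory ProbabilityTheory Finset

/-! ### Maxima of partial sums -/

/-- The maximum of the partial sums `0, x 0, x 0 + x 1, …, x 0 + ⋯ + x (n - 1)`. -/
def walkMax : ℕ → (ℕ → ℝ) → ℝ
  | 0, _ => 0
  | n + 1, x => max 0 (x 0 + walkMax n (fun i => x (i + 1)))

theorem walkMax_nonneg (n : ℕ) (x : ℕ → ℝ) : 0 ≤ walkMax n x := by
  cases n with
  | zero => exact le_rfl
  | succ n => exact le_max_left _ _

theorem walkMax_congr {n : ℕ} {x y : ℕ → ℝ} (h : ∀ i < n, x i = y i) :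
    walkMax n x = walkMax n y := by
  induction n generalizing x y with
  | zero => rfl
  | succ n ih =>
    rw [walkMax, walkMax, h 0 n.succ_pos, ih fun i hi => h (i + 1) (by omega)]

/-- The definition peels off the first increment; this form peels off the last. Spitzer's recursion
compares the two. -/
theorem walkMax_succ_eq_max (n : ℕ) (x : ℕ → ℝ) :
    walkMax (n + 1) x = max (walkMax n x) (∑ i ∈ range (n + 1), x i) := by
  induction n generalizing x with
  | zero => simp [walkMax]
  | succ n ih =>
    rw [walkMax, ih, sum_range_succ' x (n + 1), walkMax, ← max_add_add_left, ← max_assoc,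
      add_comm (x 0) (∑ i ∈ range (n + 1), x (i + 1))]

theorem sum_range_le_walkMax {n k : ℕ} (hk : k ≤ n) (x : ℕ → ℝ) :
    ∑ i ∈ range k, x i ≤ walkMax n x := by
  induction n with
  | zero => simp [Nat.le_zero.1 hk, walkMax]
  | succ n ih =>
    rw [walkMax_succ_eq_max]
    rcases Nat.le_succ_iff.1 hk with h | rfl
    · exact (ih h).trans (le_max_left _ _)
    · exact le_max_right _ _

theorem walkMax_le {n : ℕ} {x : ℕ → ℝ} {a : ℝ} (h : ∀ k ≤ n, ∑ i ∈ range k, x i ≤ a) :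
    walkMax n x ≤ a := by
  induction n with
  | zero => simpa [walkMax] using h 0 le_rfl
  | succ n ih =>
    rw [walkMax_succ_eq_max]
    exact max_le (ih fun k hk => h k (by omega)) (h _ le_rfl)

theorem walkMax_le_sum_abs (n : ℕ) (x : ℕ → ℝ) : walkMax n x ≤ ∑ i ∈ range n, |x i| :=
  walkMax_le fun _ hk => (sum_le_sum fun i _ => le_abs_self (x i)).trans
    (sum_le_sum_of_subset_of_nonneg (range_mono hk) fun _ _ _ => abs_nonneg _)

theorem continuous_walkMax (n : ℕ) : Continuous (walkMax n) := by
  induction n with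
  | zero => exact continuous_const
  | succ n ih => exact continuous_const.max ((continuous_apply 0).add (ih.comp (by fun_prop)))

/-! ### Spitzer's recursion -/

section Spitzer

variable {Ω : Type*} [MeasurableSpace Ω] {μ : Measure Ω} {X : Ω → ℕ → ℝ}

theorem integrable_walkMax (hX : ∀ i, Measurable fun ω => X ω i) {n : ℕ}
    (hi : ∀ i < n, Integrable (fun ω => X ω i) μ) : Integrable (fun ω => walkMax n (X ω)) μ := by
  refine Integrable.mono' (g := fun ω => ∑ i ∈ range n, |X ω i|)
    (integrable_finsetSum _ fun i h => (hi i (mem_range.1 h)).abs) ?_ (.of_forall fun ω => ?_)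
  · exact ((continuous_walkMax n).measurable.comp (measurable_pi_iff.2 hX)).aestronglyMeasurable
  · rw [Real.norm_of_nonneg (walkMax_nonneg _ _)]
    exact walkMax_le_sum_abs _ _

/-- Spitzer's recursion for the expected maximum of a random walk whose first `n + 1` increments
have a joint law invariant under cyclic rotation. -/
theorem integral_walkMax_succ (hX : ∀ i, Measurable fun ω => X ω i) {n : ℕ}
    (hi : ∀ i ≤ n, Integrable (fun ω => X ω i) μ) {T : Ω → Ω} (hT : MeasurePreserving T μ μ)
    (hTX : ∀ ω, ∀ i < n, X (T ω) i = X ω (i + 1)) (hTn : ∀ ω, X (T ω) n = X ω 0) :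
    ∫ ω, walkMax (n + 1) (X ω) ∂μ =
      ∫ ω, walkMax n (X ω) ∂μ + (∫ ω, max 0 (∑ i ∈ range (n + 1), X ω i) ∂μ) / (n + 1) := by
  -- The event that the full sum is positive is invariant under the rotation `T`. On it the maximum
  -- is `X 0` plus the maximum of the shifted walk; off it the last partial sum can be dropped.
  set A : Set Ω := {ω | 0 < ∑ i ∈ range (n + 1), X ω i} with hA
  have hAm : MeasurableSet A :=
    measurableSet_lt measurable_const (Finset.measurable_sum _ fun i _ => hX i)
  have hTA : T ⁻¹' A = A := by
    ext ω
    simp only [hA, Set.mem_preimage, Set.mem_ofPred_eq]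
    rw [sum_range_succ, hTn, sum_congr rfl fun i hi => hTX ω i (mem_range.1 hi),
      ← sum_range_succ']
  have hset : ∀ {g : Ω → ℝ}, Integrable g μ →
      ∫ ω in A, g (T ω) ∂μ = ∫ ω in A, g ω ∂μ := by
    intro g hg
    have hm : MeasurePreserving T (μ.restrict A) (μ.restrict A) := by
      have := hT.restrict_preimage hAm
      rwa [hTA] at this
    have := integral_map (μ := μ.restrict A) (φ := T) hm.measurable.aemeasurable (f := g)
      (by rw [hm.map_eq]; exact hg.aestronglyMeasurable.restrict)
    rw [← this, hm.map_eq]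
  -- Rotation makes all increments have the same mean on `A`, so `E[X 0; A]` is `1/(n+1)` of the
  -- mean positive part of the sum.
  have hX0 : ∀ i ≤ n, ∫ ω in A, X ω i ∂μ = ∫ ω in A, X ω 0 ∂μ := by
    intro i hin
    induction i with
    | zero => rfl
    | succ i ih =>
      rw [← ih (by omega), ← hset (hi i (by omega))]
      exact integral_congr_ae (.of_forall fun ω => (hTX ω i (by omega)).symm)
  have hpos : ∫ ω, max 0 (∑ i ∈ range (n + 1), X ω i) ∂μ = (n + 1) * ∫ ω in A, X ω 0 ∂μ := by
    have h1 : ∀ ω, max 0 (∑ i ∈ range (n + 1), X ω i) =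
        A.indicator (fun ω => ∑ i ∈ range (n + 1), X ω i) ω := by
      intro ω
      by_cases h : ω ∈ A
      · rw [Set.indicator_of_mem h, max_eq_right (le_of_lt h)]
      · rw [Set.indicator_of_notMem h, max_eq_left (not_lt.1 h)]
    simp_rw [h1]
    rw [integral_indicator hAm, integral_finsetSum _ fun i h =>
      (hi i (by simpa [Nat.lt_succ_iff] using h)).restrict,
      sum_congr rfl fun i h => hX0 i (by simpa [Nat.lt_succ_iff] using h)]
    simp
  have hM : Integrable (fun ω => walkMax n (X ω)) μ := integrable_walkMax hX fun i h => hi i h.le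
  have hsucc : ∀ ω, walkMax (n + 1) (X ω) =
      A.indicator (fun ω => X ω 0 + walkMax n (X (T ω))) ω +
        Aᶜ.indicator (fun ω => walkMax n (X ω)) ω := by
    intro ω
    by_cases h : ω ∈ A
    · have hc : ω ∉ Aᶜ := fun h' => h' h
      have h2 : walkMax n (X (T ω)) = walkMax n fun i => X ω (i + 1) :=
        walkMax_congr (hTX ω)
      rw [Set.indicator_of_mem h, Set.indicator_of_notMem hc, add_zero, h2, walkMax]
      refine max_eq_right ?_
      have h3 := sum_range_le_walkMax le_rfl (fun i => X ω (i + 1)) (n := n)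
      have h4 : 0 < ∑ i ∈ range (n + 1), X ω i := h
      rw [sum_range_succ'] at h4
      linarith
    · have hc : ω ∈ Aᶜ := h
      rw [Set.indicator_of_notMem h, Set.indicator_of_mem hc, zero_add, walkMax_succ_eq_max]
      exact max_eq_left ((not_lt.1 h).trans (walkMax_nonneg _ _))
  have hMT : Integrable (fun ω => walkMax n (X (T ω))) μ := hT.integrable_comp_of_integrable hM
  have h0 := hi 0 (Nat.zero_le _)
  have h0M : Integrable (fun ω => X ω 0 + walkMax n (X (T ω))) μ := h0.add hMT
  simp_rw [hsucc]
  rw [integral_add (h0M.indicator hAm) (hM.indicator hAm.compl), integral_indicator hAm,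
    integral_indicator hAm.compl, integral_add h0.restrict hMT.restrict,
    hset (g := fun ω => walkMax n (X ω)) hM, hpos, add_assoc, integral_add_compl hAm hM,
    mul_div_cancel_left₀ _ (by positivity), add_comm]

end Spitzer

/-! ### Projections onto closed convex sets and their behaviour under isometries -/

section Projection

variable {n : ℕ} {C : Set (EuclideanSpace ℝ (Fin n))}

theorem isNearestPoint_metricProj (hne : C.Nonempty) (hcl : IsClosed C) (hconv : Convex ℝ C)
    (x : EuclideanSpace ℝ (Fin n)) : IsNearestPoint C x (metricProj C x) :=
  (isNearestPoint_iff_eq_metricProj hne hcl hconv x _).2 rfl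

theorem inner_sub_metricProj_le_zero (hne : C.Nonempty) (hcl : IsClosed C) (hconv : Convex ℝ C)
    (x : EuclideanSpace ℝ (Fin n)) {w : EuclideanSpace ℝ (Fin n)} (hw : w ∈ C) :
    inner ℝ (x - metricProj C x) (w - metricProj C x) ≤ 0 := by
  have hp := isNearestPoint_metricProj hne hcl hconv x
  refine (norm_eq_iInf_iff_real_inner_le_zero hconv hp.1).1 ?_ w hw
  have : Nonempty C := hne.to_subtype
  refine le_antisymm (le_ciInf fun w => hp.2 w w.2) ?_
  exact ciInf_le ⟨0, by rintro _ ⟨w, rfl⟩; exact norm_nonneg _⟩ (⟨_, hp.1⟩ : C)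

/-- Add the variational inequalities at the two projections and apply Cauchy–Schwarz. -/
theorem norm_metricProj_sub_le (hne : C.Nonempty) (hcl : IsClosed C) (hconv : Convex ℝ C)
    (x y : EuclideanSpace ℝ (Fin n)) : ‖metricProj C x - metricProj C y‖ ≤ ‖x - y‖ := by
  set p := metricProj C x with hp
  set q := metricProj C y with hq
  have h1 : inner ℝ (x - p) (q - p) ≤ 0 := inner_sub_metricProj_le_zero hne hcl hconv x
    (isNearestPoint_metricProj hne hcl hconv y).1
  have h2 : inner ℝ (y - q) (p - q) ≤ 0 := inner_sub_metricProj_le_zero hne hcl hconv y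
    (isNearestPoint_metricProj hne hcl hconv x).1
  have h3 : inner ℝ (x - y) (p - q) =
      ‖p - q‖ ^ 2 - inner ℝ (x - p) (q - p) - inner ℝ (y - q) (p - q) := by
    rw [← real_inner_self_eq_norm_sq, ← neg_sub p q, inner_neg_right, sub_neg_eq_add,
      ← inner_add_left, ← inner_sub_left]
    congr 1
    abel
  have h4 := real_inner_le_norm (x - y) (p - q)
  by_contra! h
  nlinarith [norm_nonneg (x - y), norm_nonneg (p - q)]

theorem continuous_metricProj (hne : C.Nonempty) (hcl : IsClosed C) (hconv : Convex ℝ C) :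
    Continuous (metricProj C) :=
  (LipschitzWith.of_dist_le' (K := 1) fun x y => by
    simpa [dist_eq_norm] using norm_metricProj_sub_le hne hcl hconv x y).continuous

theorem norm_metricProj_le (h0 : (0 : EuclideanSpace ℝ (Fin n)) ∈ C) (hcl : IsClosed C)
    (hconv : Convex ℝ C) (x : EuclideanSpace ℝ (Fin n)) : ‖metricProj C x‖ ≤ ‖x‖ := by
  have h : metricProj C 0 = 0 :=
    ((isNearestPoint_iff_eq_metricProj ⟨0, h0⟩ hcl hconv 0 0).1 ⟨h0, fun q _ => by simp⟩).symm
  simpa [h] using norm_metricProj_sub_le ⟨0, h0⟩ hcl hconv x 0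

theorem statDimIntegrable_of_isClosed (h0 : (0 : EuclideanSpace ℝ (Fin n)) ∈ C)
    (hcl : IsClosed C) (hconv : Convex ℝ C) : StatDimIntegrable C := by
  have hc := continuous_metricProj ⟨0, h0⟩ hcl hconv
  refine Integrable.mono' (g := fun z => ‖z‖ ^ 2) ?_ (by fun_prop) (.of_forall fun z => ?_)
  · exact (IsGaussian.memLp_two_id (μ := stdGaussian (EuclideanSpace ℝ (Fin n)))).integrable_norm_pow
      two_ne_zero
  · rw [Real.norm_of_nonneg (by positivity)]
    gcongr
    exact norm_metricProj_le h0 hcl hconv z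

/-- The projection onto the image of a closed convex set under a linear isometry. -/
theorem metricProj_image {m : ℕ} {V : Set (EuclideanSpace ℝ (Fin m))} (hne : V.Nonempty)
    (hcl : IsClosed V) (hconv : Convex ℝ V)
    (f : EuclideanSpace ℝ (Fin m) →ₗᵢ[ℝ] EuclideanSpace ℝ (Fin n))
    (z : EuclideanSpace ℝ (Fin n)) :
    metricProj (f '' V) z = f (metricProj V (f.toContinuousLinearMap.adjoint z)) := by
  symm
  have hcl' : IsClosed (f '' V) := f.isometry.isClosedEmbedding.isClosedMap _ hcl
  have hconv' : Convex ℝ (f '' V) := hconv.linear_image f.toLinearMap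
  rw [← isNearestPoint_iff_eq_metricProj (hne.image f) hcl' hconv']
  have hp := isNearestPoint_metricProj hne hcl hconv (f.toContinuousLinearMap.adjoint z)
  refine ⟨Set.mem_image_of_mem f hp.1, ?_⟩
  rintro _ ⟨q, hq, rfl⟩
  -- Since `f* f = 1`, the squared distances from `z` to `f v` and from `f* z` to `v` differ by a
  -- constant independent of `v`, so they have the same minimizers.
  have key : ∀ v, ‖z - f v‖ ^ 2 = ‖z‖ ^ 2 - ‖f.toContinuousLinearMap.adjoint z‖ ^ 2 +
      ‖f.toContinuousLinearMap.adjoint z - v‖ ^ 2 := by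
    intro v
    rw [norm_sub_sq_real, norm_sub_sq_real, ContinuousLinearMap.adjoint_inner_left,
      LinearIsometry.norm_map, LinearIsometry.coe_toContinuousLinearMap]
    ring
  have h2 := hp.2 q hq
  refine (sq_le_sq₀ (norm_nonneg _) (norm_nonneg _)).1 ?_
  rw [key, key]
  gcongr

/-- Compare characteristic functions: `⟪f* z, t⟫ = ⟪z, f t⟫` and `‖f t‖ = ‖t‖`. -/
theorem map_adjoint_stdGaussian {m : ℕ}
    (f : EuclideanSpace ℝ (Fin m) →ₗᵢ[ℝ] EuclideanSpace ℝ (Fin n)) :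
    (stdGaussian (EuclideanSpace ℝ (Fin n))).map f.toContinuousLinearMap.adjoint =
      stdGaussian (EuclideanSpace ℝ (Fin m)) := by
  apply Measure.ext_of_charFun
  ext t
  rw [charFun_stdGaussian, charFun_apply, integral_map (by fun_prop) (by fun_prop)]
  simp_rw [ContinuousLinearMap.adjoint_inner_left]
  rw [← charFun_apply, charFun_stdGaussian]
  simp

theorem statDim_image {m : ℕ} {V : Set (EuclideanSpace ℝ (Fin m))} (hne : V.Nonempty)
    (hcl : IsClosed V) (hconv : Convex ℝ V)
    (f : EuclideanSpace ℝ (Fin m) →ₗᵢ[ℝ] EuclideanSpace ℝ (Fin n)) :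
    statDim (f '' V) = statDim V := by
  have hc := continuous_metricProj hne hcl hconv
  rw [statDim, statDim, ← map_adjoint_stdGaussian f, integral_map (by fun_prop) (by fun_prop)]
  simp [metricProj_image hne hcl hconv]

end Projection

theorem sum_range_dite_fin {m k : ℕ} (hk : k ≤ m) (g : Fin m → ℝ) :
    ∑ i ∈ range k, (if h : i < m then g ⟨i, h⟩ else 0) =
      ∑ i : Fin m, if (i : ℕ) < k then g i else 0 := by
  have h1 : ∀ i : Fin m, (if (i : ℕ) < k then g i else 0) =
      (fun j : ℕ => if j < k then (if h : j < m then g ⟨j, h⟩ else 0) else 0) i := by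
    intro i
    simp
  rw [sum_congr rfl fun i _ => h1 i,
    Fin.sum_univ_eq_sum_range (fun j => if j < k then (if h : j < m then g ⟨j, h⟩ else 0) else 0), ← sum_filter]
  refine sum_congr ?_ fun _ _ => rfl
  ext i
  simp only [mem_filter, mem_range]
  omega

/-! ### Isotonic regression and walk maxima -/

section MonotoneCone

theorem zero_mem_monotoneCone (m : ℕ) : (0 : EuclideanSpace ℝ (Fin m)) ∈ monotoneCone m := by
  intro i j _
  simp

theorem isClosed_monotoneCone (m : ℕ) : IsClosed (monotoneCone m) := by
  simp only [monotoneCone, Set.ofPred_forall]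
  exact isClosed_iInter fun i => isClosed_iInter fun j => isClosed_iInter fun _ =>
    isClosed_le (by fun_prop) (by fun_prop)

theorem convex_monotoneCone (m : ℕ) : Convex ℝ (monotoneCone m) := by
  intro x hx y hy a b ha hb _ i j hij
  have h1 := mul_le_mul_of_nonneg_left (hx i j hij) ha
  have h2 := mul_le_mul_of_nonneg_left (hy i j hij) hb
  simpa using add_le_add h1 h2

theorem sum_mul_sub_metricProj_le_zero {m : ℕ} (z w : EuclideanSpace ℝ (Fin m))
    (hw : metricProj (monotoneCone m) z + w ∈ monotoneCone m) :
    ∑ i, w i * (z i - metricProj (monotoneCone m) z i) ≤ 0 := by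
  have h := inner_sub_metricProj_le_zero ⟨0, zero_mem_monotoneCone m⟩ (isClosed_monotoneCone m)
    (convex_monotoneCone m) z hw
  simpa [PiLp.inner_apply] using h

/-- The truncated sums of an isotonic regression are walk maxima. -/
theorem sum_max_neg_metricProj_monotoneCone {m : ℕ} (z : EuclideanSpace ℝ (Fin m)) (t : ℝ) :
    ∑ i, max 0 (-metricProj (monotoneCone m) z i - t) =
      walkMax m (fun i => if h : i < m then -z ⟨i, h⟩ - t else 0) := by
  set u := metricProj (monotoneCone m) z with hu
  have humem : u ∈ monotoneCone m := (isNearestPoint_metricProj ⟨0, zero_mem_monotoneCone m⟩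
    (isClosed_monotoneCone m) (convex_monotoneCone m) z).1
  have hsum : ∀ k ≤ m, ∑ i ∈ range k, (if h : i < m then -z ⟨i, h⟩ - t else 0) =
      ∑ i : Fin m, if (i : ℕ) < k then -z i - t else 0 :=
    fun k hk => sum_range_dite_fin hk fun i => -z i - t
  apply le_antisymm
  · -- the set where `u < -t` is an initial segment
    set B : Finset (Fin m) := univ.filter fun i => u i < -t with hB
    have hlow : ∀ i : Fin m, (i : ℕ) < #B ↔ u i < -t := by
      intro i
      constructor
      · intro h
        by_contra hi
        have hsub : B ⊆ Iio i := fun j hj => mem_Iio.2 <| by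
          by_contra hij
          exact hi ((humem i j (not_lt.1 hij)).trans_lt (mem_filter.1 hj).2)
        have := card_le_card hsub
        rw [Fin.card_Iio] at this
        omega
      · intro h
        have hsub : Iic i ⊆ B := fun j hj =>
          mem_filter.2 ⟨mem_univ _, (humem j i (mem_Iic.1 hj)).trans_lt h⟩
        have := card_le_card hsub
        rw [Fin.card_Iic] at this
        omega
    -- `ε` is the smallest gap below the level `-t`, so raising every entry of `B` by `ε` does not
    -- cross that level and keeps `u` monotone. If `B` is empty any positive value serves.
    have hε : ∃ ε > 0, ∀ i, u i < -t → u i + ε ≤ -t := by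
      by_cases hne : B.Nonempty
      · refine ⟨B.inf' hne fun i => -t - u i, ?_, fun i hi => ?_⟩
        · rw [gt_iff_lt, Finset.lt_inf'_iff]
          intro i hi
          have := (mem_filter.1 hi).2
          linarith
        · have := Finset.inf'_le (fun i => -t - u i) (show i ∈ B by simp [hB, hi])
          linarith
      · refine ⟨1, one_pos, fun i hi => (hne ⟨i, by simp [hB, hi]⟩).elim⟩
    obtain ⟨ε, hε0, hε⟩ := hε
    have hw : u + WithLp.toLp 2 (fun i => if u i < -t then ε else 0) ∈ monotoneCone m := by
      intro i j hij
      have h1 := humem i j hij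
      by_cases hi : u i < -t <;> by_cases hj : u j < -t <;> simp [hi, hj]
      · exact h1
      · linarith [hε i hi]
      · linarith
      · exact h1
    have h1 := sum_mul_sub_metricProj_le_zero z _ hw
    rw [← hu] at h1
    -- Optimality against this raise bounds the truncated sum by the partial sum of `-z i - t` of
    -- length `#B`.
    have h2 : ∑ i, (if u i < -t then z i - u i else 0) ≤ 0 := by
      have h3 : ε * ∑ i, (if u i < -t then z i - u i else 0) ≤ 0 := by
        rw [mul_sum]
        refine le_trans (le_of_eq (sum_congr rfl fun i _ => ?_)) h1
        by_cases hi : u i < -t <;> simp [hi]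
      by_contra! h
      nlinarith
    refine le_trans ?_ (sum_range_le_walkMax (card_le_univ B |>.trans_eq (by simp)) _)
    rw [hsum _ (card_le_univ B |>.trans_eq (by simp))]
    have h4 : ∑ i, max 0 (-u i - t) = (∑ i : Fin m, if (i : ℕ) < #B then -z i - t else 0) +
        ∑ i, (if u i < -t then z i - u i else 0) := by
      rw [← sum_add_distrib]
      refine sum_congr rfl fun i _ => ?_
      by_cases hi : u i < -t
      · rw [if_pos ((hlow i).2 hi), if_pos hi, max_eq_right (by linarith)]
        ring
      · rw [if_neg (fun h => hi ((hlow i).1 h)), if_neg hi, max_eq_left (by linarith), add_zero]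
    linarith
  · refine walkMax_le fun k hk => ?_
    rw [hsum k hk]
    -- Lowering the first `k` entries keeps `u` monotone, so the `k`-th partial sum of `-z` is at
    -- most that of `-u`.
    have hw : u + WithLp.toLp 2 (fun i : Fin m => if (i : ℕ) < k then (-1 : ℝ) else 0) ∈
        monotoneCone m := by
      intro i j hij
      have h1 := humem i j hij
      have h2 : (i : ℕ) ≤ j := hij
      simp only [PiLp.add_apply]
      split_ifs <;> linarith
    have h1 := sum_mul_sub_metricProj_le_zero z _ hw
    rw [← hu] at h1
    have h3 : ∀ i : Fin m, (if (i : ℕ) < k then -z i - t else 0) ≤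
        max 0 (-u i - t) + (if (i : ℕ) < k then (-1 : ℝ) else 0) * (z i - u i) := by
      intro i
      split_ifs
      · linarith [le_max_right 0 (-u i - t)]
      · linarith [le_max_left 0 (-u i - t)]
    refine (sum_le_sum fun i _ => h3 i).trans ?_
    rw [sum_add_distrib]
    simp only at h1
    linarith

end MonotoneCone

/-- The area of a right triangle with height `x⁺` and base `x⁺ / c`. It is used with `c = 1` for
projection coordinates and `c = k + 1` for partial sums. -/
theorem lintegral_Ioi_ofReal_max_sub_mul (x : ℝ) {c : ℝ} (hc : 0 < c) :
    ∫⁻ t in Set.Ioi (0 : ℝ), ENNReal.ofReal (max 0 (x - c * t)) =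
      ENNReal.ofReal (max 0 x ^ 2 / (2 * c)) := by
  set b : ℝ := max 0 x / c with hb
  have hb0 : 0 ≤ b := div_nonneg (le_max_left _ _) hc.le
  have hcb : c * b = max 0 x := by rw [hb]; field_simp
  have hx : ∀ t ∈ Set.Ioi b, ENNReal.ofReal (max 0 (x - c * t)) = 0 := by
    intro t ht
    have h1 : c * b < c * t := mul_lt_mul_of_pos_left ht hc
    rw [max_eq_left, ENNReal.ofReal_zero]
    linarith [le_max_right 0 x]
  have hx' : ∀ t ∈ Set.Ioc 0 b, ENNReal.ofReal (max 0 (x - c * t)) =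
      ENNReal.ofReal (max 0 x - c * t) := by
    intro t ht
    have h1 : c * t ≤ c * b := mul_le_mul_of_nonneg_left ht.2 hc.le
    have h2 : 0 < c * t := mul_pos hc ht.1
    have h3 : max 0 x = x := by
      rcases max_choice 0 x with h | h
      · linarith
      · exact h
    rw [max_eq_right (by linarith), h3]
  have hint : IntegrableOn (fun t => max 0 x - c * t) (Set.Ioc 0 b) :=
    (Continuous.integrableOn_Icc (by fun_prop)).mono_set Set.Ioc_subset_Icc_self
  rw [← Set.Ioc_union_Ioi_eq_Ioi hb0, lintegral_union measurableSet_Ioi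
    (Set.disjoint_left.2 fun t h1 h2 => absurd h1.2 (not_le.2 h2)),
    setLIntegral_congr_fun measurableSet_Ioi hx, setLIntegral_congr_fun measurableSet_Ioc hx',
    ← ofReal_integral_eq_lintegral_ofReal hint, ← intervalIntegral.integral_of_le hb0]
  · have hid : ∫ t in (0 : ℝ)..b, c * t = c * (b ^ 2 / 2) := by
      rw [intervalIntegral.integral_const_mul, integral_id]
      ring
    rw [intervalIntegral.integral_sub (f := fun _ => max 0 x) (g := fun t => c * t) (by simp)
      ((by fun_prop : Continuous fun t : ℝ => c * t).intervalIntegrable _ _), hid]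
    simp only [intervalIntegral.integral_const, lintegral_zero, add_zero]
    congr 1
    rw [← hcb]
    simp only [smul_eq_mul]
    field_simp
    ring
  · refine (ae_restrict_iff' measurableSet_Ioc).2 (.of_forall fun t ht => ?_)
    have h1 : c * t ≤ c * b := mul_le_mul_of_nonneg_left ht.2 hc.le
    simpa using h1.trans_eq hcb

/-! ### Gaussian expectations and the harmonic sum -/

section Gaussian

variable {m : ℕ}

theorem measurePreserving_perm_stdGaussian (σ : Equiv.Perm (Fin m)) :
    MeasurePreserving (fun z : EuclideanSpace ℝ (Fin m) => WithLp.toLp 2 fun i => z (σ i))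
      (stdGaussian (EuclideanSpace ℝ (Fin m))) (stdGaussian (EuclideanSpace ℝ (Fin m))) := by
  have h : (fun z : EuclideanSpace ℝ (Fin m) => WithLp.toLp 2 fun i => z (σ i)) =
      LinearIsometryEquiv.piLpCongrLeft 2 ℝ ℝ σ.symm := by
    ext z i
    simp [LinearIsometryEquiv.piLpCongrLeft_apply, Equiv.piCongrLeft'_apply]
  rw [h]
  exact ⟨by fun_prop, stdGaussian_map _⟩

theorem integrable_coord_stdGaussian (i : Fin m) :
    Integrable (fun z : EuclideanSpace ℝ (Fin m) => z i)
      (stdGaussian (EuclideanSpace ℝ (Fin m))) :=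
  IsGaussian.integrable_dual _ (EuclideanSpace.proj i)

/-- The increments `-z i - t`, extended by zero. -/
noncomputable def negIncrement (t : ℝ) (z : EuclideanSpace ℝ (Fin m)) (i : ℕ) : ℝ :=
  if h : i < m then -z ⟨i, h⟩ - t else 0

theorem continuous_negIncrement (i : ℕ) :
    Continuous fun p : EuclideanSpace ℝ (Fin m) × ℝ => negIncrement p.2 p.1 i := by
  unfold negIncrement
  split_ifs <;> fun_prop

theorem measurable_negIncrement (t : ℝ) (i : ℕ) :
    Measurable fun z : EuclideanSpace ℝ (Fin m) => negIncrement t z i :=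
  ((continuous_negIncrement i).comp (by fun_prop : Continuous fun z => (z, t))).measurable

theorem integrable_negIncrement (t : ℝ) (i : ℕ) :
    Integrable (fun z : EuclideanSpace ℝ (Fin m) => negIncrement t z i)
      (stdGaussian (EuclideanSpace ℝ (Fin m))) := by
  unfold negIncrement
  split_ifs with h
  · exact (integrable_coord_stdGaussian ⟨i, h⟩).neg.sub (integrable_const t)
  · exact integrable_zero _ _ _

theorem integral_walkMax_negIncrement (t : ℝ) {n : ℕ} (hn : n ≤ m) :
    ∫ z, walkMax n (negIncrement t z) ∂stdGaussian (EuclideanSpace ℝ (Fin m)) =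
      ∑ k ∈ range n, (∫ z, max 0 (∑ i ∈ range (k + 1), negIncrement t z i)
        ∂stdGaussian (EuclideanSpace ℝ (Fin m))) / (k + 1) := by
  induction n with
  | zero => simp [walkMax]
  | succ n ih =>
    rw [sum_range_succ, ← ih (by omega)]
    have hnm : n < m := by omega
    refine integral_walkMax_succ (measurable_negIncrement t)
      (fun i _ => integrable_negIncrement t i)
      -- This cycle sends `i` to `i + 1` for `i < n` and `n` to `0`: exactly the rotation required
      -- by Spitzer's recursion.
      (measurePreserving_perm_stdGaussian (Fin.cycleRange ⟨n, hnm⟩)) (fun z i hi => ?_) fun z => ?_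
    · have h1 : i < m := by omega
      have h2 : i + 1 < m := by omega
      have h3 : Fin.cycleRange ⟨n, hnm⟩ ⟨i, h1⟩ = ⟨i + 1, h2⟩ :=
        Fin.ext (Fin.coe_cycleRange_of_lt (Fin.mk_lt_mk.2 hi))
      simp [negIncrement, h1, h2, h3]
    · have h0 : 0 < m := by omega
      have : NeZero m := ⟨h0.ne'⟩
      have h3 : Fin.cycleRange (⟨n, hnm⟩ : Fin m) ⟨n, hnm⟩ = ⟨0, h0⟩ := Fin.cycleRange_self _
      simp [negIncrement, hnm, h0, h3]

theorem integral_sq_inner_stdGaussian (e : EuclideanSpace ℝ (Fin m)) :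
    ∫ z, inner ℝ e z ^ 2 ∂stdGaussian (EuclideanSpace ℝ (Fin m)) = ‖e‖ ^ 2 := by
  have h := variance_dual_stdGaussian (innerSL ℝ e)
  rw [variance_of_integral_eq_zero (by fun_prop) (integral_strongDual_stdGaussian _),
    innerSL_apply_norm] at h
  simpa using h

theorem integrable_sq_inner_stdGaussian (e : EuclideanSpace ℝ (Fin m)) :
    Integrable (fun z => inner ℝ e z ^ 2) (stdGaussian (EuclideanSpace ℝ (Fin m))) :=
  (IsGaussian.memLp_dual (stdGaussian (EuclideanSpace ℝ (Fin m))) (innerSL ℝ e) 2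
    (by simp)).integrable_sq

theorem max_zero_sq_add_max_zero_neg_sq (x : ℝ) : max 0 x ^ 2 + max 0 (-x) ^ 2 = x ^ 2 := by
  rcases le_total 0 x with h | h
  · rw [max_eq_right h, max_eq_left (by linarith)]; ring
  · rw [max_eq_left h, max_eq_right (by linarith)]; ring

theorem integrable_max_zero_sq_inner_stdGaussian (e : EuclideanSpace ℝ (Fin m)) :
    Integrable (fun z => max 0 (inner ℝ e z) ^ 2) (stdGaussian (EuclideanSpace ℝ (Fin m))) := by
  refine (integrable_sq_inner_stdGaussian e).mono' (by fun_prop) (.of_forall fun z => ?_)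
  rw [Real.norm_of_nonneg (by positivity), ← max_zero_sq_add_max_zero_neg_sq (inner ℝ e z)]
  exact le_add_of_nonneg_right (by positivity)

/-- By the symmetry `z ↦ -z`, positive and negative parts share the second moment equally. -/
theorem integral_max_zero_sq_inner_stdGaussian (e : EuclideanSpace ℝ (Fin m)) :
    ∫ z, max 0 (inner ℝ e z) ^ 2 ∂stdGaussian (EuclideanSpace ℝ (Fin m)) = ‖e‖ ^ 2 / 2 := by
  have h1 : ∫ z, max 0 (inner ℝ e (-z)) ^ 2 ∂stdGaussian (EuclideanSpace ℝ (Fin m)) =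
      ∫ z, max 0 (inner ℝ e z) ^ 2 ∂stdGaussian (EuclideanSpace ℝ (Fin m)) := by
    conv_rhs => rw [← stdGaussian_map (LinearIsometryEquiv.neg ℝ)]
    rw [integral_map (by fun_prop) (by fun_prop)]
    simp
  have h2 := integral_sq_inner_stdGaussian e
  simp_rw [← max_zero_sq_add_max_zero_neg_sq (inner ℝ e _), ← inner_neg_right] at h2
  have h3 : Integrable (fun z => max 0 (inner ℝ e (-z)) ^ 2)
      (stdGaussian (EuclideanSpace ℝ (Fin m))) := by
    simpa using integrable_max_zero_sq_inner_stdGaussian (-e)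
  rw [integral_add (integrable_max_zero_sq_inner_stdGaussian e) h3, h1] at h2
  linarith

/-- The partial sum is `⟪e, z⟫ - (k + 1) t` with `‖e‖² = k + 1`. The variance cancels the slope:
`((k + 1) / 2) / (2 (k + 1)) = 1/4`, whatever `k` is. -/
theorem lintegral_lintegral_sum_negIncrement {k : ℕ} (hk : k + 1 ≤ m) :
    ∫⁻ t in Set.Ioi (0 : ℝ), ∫⁻ z, ENNReal.ofReal (max 0 (∑ i ∈ range (k + 1), negIncrement t z i))
      ∂stdGaussian (EuclideanSpace ℝ (Fin m)) = ENNReal.ofReal (1 / 4) := by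
  set e : EuclideanSpace ℝ (Fin m) := WithLp.toLp 2 fun i => if (i : ℕ) < k + 1 then -1 else 0
    with he
  have hcount : ∀ a : ℝ, ∑ i : Fin m, (if (i : ℕ) < k + 1 then a else 0) = (k + 1) * a := by
    intro a
    have h := sum_range_dite_fin hk fun _ => a
    rw [← h, sum_congr rfl fun i hi => dif_pos (lt_of_lt_of_le (mem_range.1 hi) hk)]
    simp
  have hnorm : ‖e‖ ^ 2 = k + 1 := by
    rw [EuclideanSpace.real_norm_sq_eq, ← mul_one ((k : ℝ) + 1), ← hcount]
    refine sum_congr rfl fun i _ => ?_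
    simp only [he]
    split_ifs <;> simp
  have hsum : ∀ (t : ℝ) (z : EuclideanSpace ℝ (Fin m)),
      ∑ i ∈ range (k + 1), negIncrement t z i = inner ℝ e z - (k + 1) * t := by
    intro t z
    unfold negIncrement
    rw [sum_range_dite_fin hk fun i => -z i - t, ← hcount t, PiLp.inner_apply, ← sum_sub_distrib]
    refine sum_congr rfl fun i _ => ?_
    simp only [he]
    split_ifs <;> simp
  simp_rw [hsum]
  rw [lintegral_lintegral_swap (by fun_prop)]
  simp_rw [lintegral_Ioi_ofReal_max_sub_mul _ (by positivity : (0 : ℝ) < k + 1)]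
  rw [← ofReal_integral_eq_lintegral_ofReal
    ((integrable_max_zero_sq_inner_stdGaussian e).div_const _) (.of_forall fun z => by positivity),
    integral_div, integral_max_zero_sq_inner_stdGaussian, hnorm]
  congr 1
  field_simp
  norm_num

theorem lintegral_walkMax_negIncrement (t : ℝ) :
    ∫⁻ z, ENNReal.ofReal (walkMax m (negIncrement t z))
      ∂stdGaussian (EuclideanSpace ℝ (Fin m)) =
    ∑ k ∈ range m, ENNReal.ofReal (1 / (k + 1)) *
      ∫⁻ z, ENNReal.ofReal (max 0 (∑ i ∈ range (k + 1), negIncrement t z i))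
        ∂stdGaussian (EuclideanSpace ℝ (Fin m)) := by
  rw [← ofReal_integral_eq_lintegral_ofReal
    (integrable_walkMax (measurable_negIncrement t) fun i _ => integrable_negIncrement t i)
    (.of_forall fun z => walkMax_nonneg _ _), integral_walkMax_negIncrement t le_rfl,
    ENNReal.ofReal_sum_of_nonneg fun k _ => ?_]
  swap
  · exact div_nonneg (integral_nonneg fun z => le_max_left _ _) (by positivity)
  refine sum_congr rfl fun k _ => ?_
  have hi : Integrable (fun z : EuclideanSpace ℝ (Fin m) =>
      max 0 (∑ i ∈ range (k + 1), negIncrement t z i)) (stdGaussian _) :=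
    (integrable_zero _ _ _).sup (integrable_finsetSum _ fun i _ => integrable_negIncrement t i)
  rw [← ofReal_integral_eq_lintegral_ofReal hi (.of_forall fun z => le_max_left _ _),
    ← ENNReal.ofReal_mul (by positivity), div_eq_mul_inv, one_div, mul_comm]

/-- Each squared negative part is an integral over levels `t`; Tonelli exchanges it with the
expectation, so that Spitzer's identity applies at each fixed level. -/
theorem lintegral_sum_max_zero_neg_metricProj_sq :
    ∫⁻ z, ∑ i, ENNReal.ofReal (max 0 (-metricProj (monotoneCone m) z i) ^ 2 / 2)
      ∂stdGaussian (EuclideanSpace ℝ (Fin m)) =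
    ENNReal.ofReal (∑ k ∈ range m, 1 / (4 * ((k : ℝ) + 1))) := by
  have hcont : Continuous fun p : EuclideanSpace ℝ (Fin m) × ℝ =>
      walkMax m (negIncrement p.2 p.1) :=
    (continuous_walkMax m).comp (continuous_pi continuous_negIncrement)
  have hsumc : ∀ k, Continuous fun p : ℝ × EuclideanSpace ℝ (Fin m) =>
      ∑ i ∈ range (k + 1), negIncrement p.1 p.2 i := fun k =>
    continuous_finsetSum _ fun i _ => (continuous_negIncrement i).comp continuous_swap
  have hz : ∀ z : EuclideanSpace ℝ (Fin m),
      ∑ i, ENNReal.ofReal (max 0 (-metricProj (monotoneCone m) z i) ^ 2 / 2) =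
        ∫⁻ t in Set.Ioi (0 : ℝ), ENNReal.ofReal (walkMax m (negIncrement t z)) := by
    intro z
    have h1 : ∀ t, ENNReal.ofReal (walkMax m (negIncrement t z)) =
        ∑ i, ENNReal.ofReal (max 0 (-metricProj (monotoneCone m) z i - 1 * t)) := by
      intro t
      rw [← ENNReal.ofReal_sum_of_nonneg fun i _ => le_max_left _ _, one_mul,
        sum_max_neg_metricProj_monotoneCone]
      rfl
    simp_rw [h1]
    rw [lintegral_finsetSum _ fun i _ => by fun_prop]
    simp_rw [lintegral_Ioi_ofReal_max_sub_mul _ one_pos, mul_one]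
  simp_rw [hz]
  rw [lintegral_lintegral_swap (hcont.measurable.ennreal_ofReal.aemeasurable)]
  simp_rw [lintegral_walkMax_negIncrement]
  rw [lintegral_finsetSum' _ fun k _ => ?_, ENNReal.ofReal_sum_of_nonneg fun k _ => by positivity]
  · refine sum_congr rfl fun k hk => ?_
    rw [lintegral_const_mul' _ _ ENNReal.ofReal_ne_top,
      lintegral_lintegral_sum_negIncrement (mem_range.1 hk), ← ENNReal.ofReal_mul (by positivity)]
    congr 1
    field_simp
  · refine AEMeasurable.const_mul (Measurable.aemeasurable ?_) _
    exact Measurable.lintegral_prod_right'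
      (continuous_const.max (hsumc k)).measurable.ennreal_ofReal

/-- Negation combined with reversal of the coordinates. -/
noncomputable def negRev (m : ℕ) : EuclideanSpace ℝ (Fin m) ≃ₗᵢ[ℝ] EuclideanSpace ℝ (Fin m) :=
  (LinearIsometryEquiv.piLpCongrLeft 2 ℝ ℝ Fin.revPerm).trans (LinearIsometryEquiv.neg ℝ)

theorem negRev_apply (z : EuclideanSpace ℝ (Fin m)) (i : Fin m) : negRev m z i = -z i.rev := by
  simp [negRev, LinearIsometryEquiv.piLpCongrLeft_apply, Equiv.piCongrLeft'_apply]

theorem image_negRev_monotoneCone : negRev m '' monotoneCone m = monotoneCone m := by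
  have hmem : ∀ z ∈ monotoneCone m, negRev m z ∈ monotoneCone m := by
    intro z hz i j hij
    rw [negRev_apply, negRev_apply]
    exact neg_le_neg (hz _ _ (Fin.rev_le_rev.2 hij))
  refine Set.Subset.antisymm (Set.image_subset_iff.2 hmem) fun z hz => ⟨_, hmem z hz, ?_⟩
  ext i
  simp [negRev_apply]

theorem metricProj_monotoneCone_negRev (z : EuclideanSpace ℝ (Fin m)) :
    metricProj (monotoneCone m) (negRev m z) = negRev m (metricProj (monotoneCone m) z) := by
  have h := metricProj_image ⟨0, zero_mem_monotoneCone m⟩ (isClosed_monotoneCone m)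
    (convex_monotoneCone m) (negRev m).toLinearIsometry (negRev m z)
  have h2 : (negRev m).toLinearIsometry.toContinuousLinearMap.adjoint (negRev m z) = z := by
    refine ext_inner_right ℝ fun v => ?_
    rw [ContinuousLinearMap.adjoint_inner_left]
    exact (negRev m).inner_map_map z v
  rw [h2] at h
  simpa [image_negRev_monotoneCone] using h

theorem sum_Icc_one_div_eq_sum_range (m : ℕ) :
    ∑ j ∈ Icc 1 m, (1 : ℝ) / (j : ℝ) = ∑ k ∈ range m, 1 / ((k : ℝ) + 1) := by
  induction m with
  | zero => simp
  | succ m ih => rw [sum_Icc_succ_top (by omega), ih, sum_range_succ, Nat.cast_succ]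

theorem statDim_monotoneCone (m : ℕ) :
    statDim (monotoneCone m) = ∑ j ∈ Icc 1 m, (1 : ℝ) / (j : ℝ) := by
  have hne : (monotoneCone m).Nonempty := ⟨0, zero_mem_monotoneCone m⟩
  have hc := continuous_metricProj hne (isClosed_monotoneCone m) (convex_monotoneCone m)
  set N : EuclideanSpace ℝ (Fin m) → ℝ :=
    fun z => ∑ i, max 0 (-metricProj (monotoneCone m) z i) ^ 2 with hN
  have hN0 : ∀ z, 0 ≤ N z := fun z => sum_nonneg fun i _ => by positivity
  have hNc : Continuous N := by fun_prop
  have hNrev : ∀ z, N (negRev m z) = ∑ i, max 0 (metricProj (monotoneCone m) z i) ^ 2 := by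
    intro z
    simp only [hN, metricProj_monotoneCone_negRev, negRev_apply, neg_neg]
    exact Equiv.sum_comp Fin.revPerm fun i => max 0 (metricProj (monotoneCone m) z i) ^ 2
  -- Positive parts of the projection of `z` are negative parts of the projection of `negRev m z`,
  -- so both halves have the same mean.
  have hsplit : ∀ z, ‖metricProj (monotoneCone m) z‖ ^ 2 = N (negRev m z) + N z := by
    intro z
    rw [hNrev, EuclideanSpace.real_norm_sq_eq, ← sum_add_distrib]
    exact sum_congr rfl fun i _ => (max_zero_sq_add_max_zero_neg_sq _).symm
  have hpres : MeasurePreserving (negRev m) (stdGaussian (EuclideanSpace ℝ (Fin m)))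
      (stdGaussian (EuclideanSpace ℝ (Fin m))) := ⟨by fun_prop, stdGaussian_map _⟩
  have hNi : Integrable N (stdGaussian (EuclideanSpace ℝ (Fin m))) := by
    refine Integrable.mono' (statDimIntegrable_of_isClosed (zero_mem_monotoneCone m)
      (isClosed_monotoneCone m) (convex_monotoneCone m)) (by fun_prop) (.of_forall fun z => ?_)
    rw [Real.norm_of_nonneg (hN0 z), hsplit]
    exact le_add_of_nonneg_left (hN0 _)
  have hrev : ∫ z, N (negRev m z) ∂stdGaussian (EuclideanSpace ℝ (Fin m)) =
      ∫ z, N z ∂stdGaussian (EuclideanSpace ℝ (Fin m)) :=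
    hpres.integral_comp (negRev m).toHomeomorph.measurableEmbedding N
  have hval : ∫ z, N z / 2 ∂stdGaussian (EuclideanSpace ℝ (Fin m)) =
      ∑ k ∈ range m, 1 / (4 * ((k : ℝ) + 1)) := by
    rw [integral_eq_lintegral_of_nonneg_ae
      (.of_forall fun z => div_nonneg (hN0 z) zero_le_two) (by fun_prop)]
    have h1 : ∀ z, ENNReal.ofReal (N z / 2) =
        ∑ i, ENNReal.ofReal (max 0 (-metricProj (monotoneCone m) z i) ^ 2 / 2) := by
      intro z
      rw [← ENNReal.ofReal_sum_of_nonneg fun i _ => by positivity, ← sum_div]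
    simp_rw [h1]
    rw [lintegral_sum_max_zero_neg_metricProj_sq,
      ENNReal.toReal_ofReal (sum_nonneg fun k _ => by positivity)]
  rw [integral_div] at hval
  rw [statDim]
  simp_rw [hsplit]
  have hNi' : Integrable (fun z => N (negRev m z)) (stdGaussian (EuclideanSpace ℝ (Fin m))) :=
    hpres.integrable_comp_of_integrable hNi
  rw [integral_add hNi' hNi, hrev, sum_Icc_one_div_eq_sum_range]
  have h4 : ∑ k ∈ range m, 1 / ((k : ℝ) + 1) = 4 * ∑ k ∈ range m, 1 / (4 * ((k : ℝ) + 1)) := by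
    rw [mul_sum]
    exact sum_congr rfl fun k _ => by field_simp
  rw [h4, ← hval]
  ring

end Gaussian

/-! ### The scaled monotone cone -/

section ScaledCone

variable {m : ℕ} (s : Fin m → ℕ)

theorem zero_mem_scaledMonotoneCone : (0 : EuclideanSpace ℝ (Fin m)) ∈ scaledMonotoneCone s := by
  intro i j _
  simp

theorem isClosed_scaledMonotoneCone : IsClosed (scaledMonotoneCone s) := by
  simp only [scaledMonotoneCone, Set.ofPred_forall]
  exact isClosed_iInter fun i => isClosed_iInter fun j => isClosed_iInter fun _ =>
    isClosed_le (by fun_prop) (by fun_prop)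

theorem convex_scaledMonotoneCone : Convex ℝ (scaledMonotoneCone s) := by
  intro x hx y hy a b ha hb _ i j hij
  have h1 := mul_le_mul_of_nonneg_left (hx i j hij) ha
  have h2 := mul_le_mul_of_nonneg_left (hy i j hij) hb
  simpa [add_div, mul_div_assoc] using add_le_add h1 h2

theorem scaledMonotoneCone_eq_monotoneCone {s : Fin m → ℕ} (hpos : ∀ j, 0 < s j)
    (hs : ∀ i j, s i = s j) : scaledMonotoneCone s = monotoneCone m := by
  ext v
  refine forall₃_congr fun i j _ => ?_
  rw [hs j i]
  exact div_le_div_iff_of_pos_right (Real.sqrt_pos.2 (Nat.cast_pos.2 (hpos i)))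

end ScaledCone

/-! ### The isometry onto the block cone -/

namespace IsBlockPartition

variable {n m : ℕ} {I : Fin m → Finset (Fin n)}

theorem nonempty (hI : IsBlockPartition I) (j : Fin m) : (I j).Nonempty := by
  obtain ⟨k, l, hkl, h⟩ := hI.isBlock j
  exact ⟨k, h ▸ left_mem_Icc.2 hkl⟩

theorem le_of_le (hI : IsBlockPartition I) {i j : Fin m} {a b : Fin n} (ha : a ∈ I i)
    (hb : b ∈ I j) (hab : a ≤ b) : i ≤ j := by
  by_contra h
  exact absurd (hI.increasing j i (not_le.1 h) b hb a ha) (not_lt.2 hab)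

theorem eq_of_mem (hI : IsBlockPartition I) {i j : Fin m} {a : Fin n} (hi : a ∈ I i)
    (hj : a ∈ I j) : i = j :=
  le_antisymm (hI.le_of_le hi hj le_rfl) (hI.le_of_le hj hi le_rfl)

/-- The index of the block containing `a`. -/
noncomputable def blockIndex (hI : IsBlockPartition I) (a : Fin n) : Fin m :=
  (hI.cover a).choose

theorem mem_blockIndex (hI : IsBlockPartition I) (a : Fin n) : a ∈ I (hI.blockIndex a) :=
  (hI.cover a).choose_spec

theorem filter_blockIndex (hI : IsBlockPartition I) (j : Fin m) :
    univ.filter (fun a => hI.blockIndex a = j) = I j := by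
  ext a
  simp only [mem_filter, mem_univ, true_and]
  exact ⟨fun h => h ▸ hI.mem_blockIndex a, fun h => hI.eq_of_mem (hI.mem_blockIndex a) h⟩

theorem sqrt_card_pos (hI : IsBlockPartition I) (j : Fin m) : 0 < √((I j).card : ℝ) :=
  Real.sqrt_pos.2 (Nat.cast_pos.2 (hI.nonempty j).card_pos)

/-- The linear isometry spreading the `j`-th coordinate evenly over the `j`-th block. -/
noncomputable def blockIsometry (hI : IsBlockPartition I) :
    EuclideanSpace ℝ (Fin m) →ₗᵢ[ℝ] EuclideanSpace ℝ (Fin n) where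
  toFun v := WithLp.toLp 2 fun a => v (hI.blockIndex a) / √((I (hI.blockIndex a)).card : ℝ)
  map_add' v w := by
    ext a
    simp [add_div]
  map_smul' c v := by
    ext a
    simp [mul_div_assoc]
  norm_map' v := by
    refine (sq_eq_sq₀ (norm_nonneg _) (norm_nonneg _)).1 ?_
    rw [EuclideanSpace.real_norm_sq_eq, EuclideanSpace.real_norm_sq_eq,
      ← sum_fiberwise univ hI.blockIndex]
    refine sum_congr rfl fun j _ => ?_
    have h : ∀ a ∈ univ.filter (fun a => hI.blockIndex a = j),
        (v (hI.blockIndex a) / √((I (hI.blockIndex a)).card : ℝ)) ^ 2 = v j ^ 2 / (I j).card := by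
      intro a ha
      rw [(mem_filter.1 ha).2, div_pow, Real.sq_sqrt (Nat.cast_nonneg _)]
    have hc : ((I j).card : ℝ) ≠ 0 := Nat.cast_ne_zero.2 (hI.nonempty j).card_pos.ne'
    refine (sum_congr rfl h).trans ?_
    rw [sum_const, hI.filter_blockIndex, nsmul_eq_mul]
    field_simp

theorem blockIsometry_apply (hI : IsBlockPartition I) (v : EuclideanSpace ℝ (Fin m)) (a : Fin n) :
    hI.blockIsometry v a = v (hI.blockIndex a) / √((I (hI.blockIndex a)).card : ℝ) :=
  rfl

theorem image_blockIsometry (hI : IsBlockPartition I) :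
    hI.blockIsometry '' scaledMonotoneCone (fun j => (I j).card) = blockMonotoneCone I := by
  refine Set.Subset.antisymm ?_ fun u hu => ?_
  · rintro _ ⟨v, hv, rfl⟩
    refine ⟨fun a b hab => ?_, fun j a ha b hb => ?_⟩
    · rw [blockIsometry_apply, blockIsometry_apply]
      exact hv _ _ (hI.le_of_le (hI.mem_blockIndex a) (hI.mem_blockIndex b) hab)
    · rw [blockIsometry_apply, blockIsometry_apply, hI.eq_of_mem (hI.mem_blockIndex a) ha,
        hI.eq_of_mem (hI.mem_blockIndex b) hb]
  · choose r hr using hI.nonempty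
    have hdiv : ∀ j, √((I j).card : ℝ) * u (r j) / √((I j).card : ℝ) = u (r j) := fun j =>
      mul_div_cancel_left₀ _ (hI.sqrt_card_pos j).ne'
    -- The preimage of `u` rescales its constant value on block `j`, read off at any representative
    -- `r j`.
    refine ⟨WithLp.toLp 2 fun j => √((I j).card : ℝ) * u (r j), fun i j hij => ?_, ?_⟩
    · simp only [hdiv]
      rcases hij.eq_or_lt with rfl | h
      · exact le_rfl
      · exact hu.1 _ _ (hI.increasing i j h _ (hr i) _ (hr j)).le
    · ext a
      simp only [blockIsometry_apply, hdiv]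
      exact hu.2 _ _ (hr _) _ (hI.mem_blockIndex a)

end IsBlockPartition

theorem lemma5 {n m : ℕ} (I : Fin m → Finset (Fin n)) (hI : IsBlockPartition I) :
    (∃ f : EuclideanSpace ℝ (Fin m) →ₗᵢ[ℝ] EuclideanSpace ℝ (Fin n),
      f '' scaledMonotoneCone (fun j => (I j).card) = blockMonotoneCone I) ∧
    (StatDimIntegrable (blockMonotoneCone I) ∧
      StatDimIntegrable (scaledMonotoneCone (fun j => (I j).card)) ∧
      statDim (blockMonotoneCone I) = statDim (scaledMonotoneCone (fun j => (I j).card))) ∧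
    ((∀ i j, (I i).card = (I j).card) →
      statDim (blockMonotoneCone I) = ∑ j ∈ Finset.Icc 1 m, (1 : ℝ) / (j : ℝ)) := by
  have h0 := zero_mem_scaledMonotoneCone fun j => (I j).card
  have hcl := isClosed_scaledMonotoneCone fun j => (I j).card
  have hconv := convex_scaledMonotoneCone fun j => (I j).card
  have himg := hI.image_blockIsometry
  have hdim : statDim (blockMonotoneCone I) =
      statDim (scaledMonotoneCone fun j => (I j).card) := by
    rw [← himg]
    exact statDim_image ⟨0, h0⟩ hcl hconv _
  refine ⟨⟨hI.blockIsometry, himg⟩, ⟨?_, statDimIntegrable_of_isClosed h0 hcl hconv, hdim⟩,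
    fun hs => ?_⟩
  · rw [← himg]
    exact statDimIntegrable_of_isClosed ⟨0, h0, map_zero _⟩
      (hI.blockIsometry.isometry.isClosedEmbedding.isClosedMap _ hcl)
      (hconv.linear_image hI.blockIsometry.toLinearMap)
  · rw [hdim, scaledMonotoneCone_eq_monotoneCone (fun j => (hI.nonempty j).card_pos) hs,
      statDim_monotoneCone]
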